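/- Let $\mathbb E$ be a finite-dimensional real Euclidean space and let $\Gamma_0(\mathbb E)$ denote the set of proper closed convex functions $f:\mathbb E\to\mathbb R\cup\{+\infty\}$. For such a function let $\operatorname{dom} f=\{x: f(x)<+\infty\}$, let $\partial f$ be its convex subdifferential and $f^*(y)=\sup_x\{\langle y,x\rangle-f(x)\}$ its Fenchel conjugate. For any proper $f:\mathbb E\to\mathbb R\cup\{+\infty\}$ and $\lambda>0$ let $$e_\lambda f(x)=\inf_{u\in\mathbb E}\Big\{f(u)+\tfrac1{2\lambda}\|x-u\|^2\Big\},\qquad P_\lambda f(x)=\operatorname*{argmin}_{u\in\mathbb E}\Big\{f(u)+\tfrac1{2\lambda}\|x-u\|^2\Big\}$$ be the Moreau envelope and the proximal map ($P_\lambda f(x)$ is read as the set of minimizers). $P_C$ and $d_C$ denote the Euclidean projection onto, and the distance to, a nonempty closed convex set $C$. Let $g\in\Gamma_0(\mathbb R)$ be increasing (i.e. nondecreasing) and $\psi\in\Gamma_0(\mathbb E)$ with $$(\operatorname{ri}\operatorname{dom} g)\cap\psi(\operatorname{ri}\operatorname{dom}\psi)\neq\emptyset ,$$ and let $\bar x\in\mathbb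 E$. Let $g\circ\psi$ be $g(\psi(x))$ for $x\in\operatorname{dom}\psi$ and $+\infty$ otherwise. For $\lambda\ge 0$ let $\lambda\cdot\psi$ be $\lambda\psi(x)$ for $x\in\operatorname{dom}\psi$ and $+\infty$ otherwise (so $0\cdot\psi$ is the indicator function of $\operatorname{dom}\psi$). With $D=\operatorname{cl}(\operatorname{dom}\psi)$ let $$\bar\phi^\psi_{\bar x}(\lambda)=\begin{cases}-\lambda e_\lambda\psi(\bar x)&\text{if }\lambda>0,\\ -\tfrac12 d_D^2(\bar x)&\text{if }\lambda=0,\\ -\lambda\psi(P_D(\bar x))-\tfrac12 d_D^2(\bar x)&\text{if }\lambda<0.\end{cases}$$ Then the following hold. (a) $e_1(g\circ\psi)(\bar x)=-\min_{\lambda\ge0}\{g^*(\lambda)+\bar\phi^\psi_{\bar x}(\lambda)\}$, where the minimum is attained and finite. (b) The set $\Lambda:=\operatorname*{argmin}_{\lambda\ge0}\{g^*(\lambda)+\bar\phi^\psi_{\bar x}(\lambda)\}$ is nonempty, and $P_1(g\circ\psi)(\bar x)=P_1(\bar\lambda\cdot\psi)(\bar x)$ for every $\bar\lambda\in\Lambda$.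 If $g$ is not constant, this set consists of exactly one point. (c) Suppose that $g$ is not constant. If $\psi(P_D(\bar x))\notin\partial g^*(0)$, then $\Lambda\subset(0,\infty)$. In particular, if $P_D(\bar x)\notin\operatorname{dom}\psi$, then $\psi(P_D(\bar x))=+\infty\notin\partial g^*(0)$ and hence $\Lambda\subset(0,\infty)$. -/

import Mathlib

noncomputable section

namespace PostComposition

variable {E : Type*} [NormedAddCommGroup E] [InnerProductSpace ℝ E]

/-- The effective domain of an extended-real-valued function. -/
def effDom (f : E → EReal) : Set E := {x | f x < ⊤}

/-- The epigraph, as a subset of `E × ℝ`. -/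
def epi (f : E → EReal) : Set (E × ℝ) := {p | f p.1 ≤ (p.2 : EReal)}

/-- The class `Γ₀(E)` of proper closed convex functions. -/
structure IsGamma0 (f : E → EReal) : Prop where
  ne_bot : ∀ x, f x ≠ ⊥
  dom_nonempty : (effDom f).Nonempty
  closed_epi : IsClosed (epi f)
  convex_epi : Convex ℝ (epi f)

/-- The Fenchel conjugate `f*(y) = sup_x {⟨y, x⟩ - f(x)}`. -/
def conj (f : E → EReal) (y : E) : EReal :=
  ⨆ x : E, ((inner ℝ y x : ℝ) : EReal) - f x

/-- The convex subdifferential `∂f(x)`. -/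
def subdiff (f : E → EReal) (x : E) : Set E :=
  {v | ∀ y : E, f x + ((inner ℝ v (y - x) : ℝ) : EReal) ≤ f y}

/-- The set of minimizers of `F` over `S`. -/
def argminOn {α : Type*} (F : α → EReal) (S : Set α) : Set α :=
  {x ∈ S | IsMinOn F S x}

/-- The function `u ↦ f(u) + (1/2t)‖x - u‖²`. -/
def proxObj (t : ℝ) (f : E → EReal) (x u : E) : EReal :=
  f u + ((1 / (2 * t) * ‖x - u‖ ^ 2 : ℝ) : EReal)

/-- The Moreau envelope `e_t f(x)` (for `t > 0`). -/
def moreauEnv (t : ℝ) (f : E → EReal) (x : E) : EReal :=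
  ⨅ u : E, proxObj t f x u

/-- The proximal map `P_t f(x)` (for `t > 0`), as the set of minimizers of the proximal problem. -/
def proxSet (t : ℝ) (f : E → EReal) (x : E) : Set E :=
  argminOn (proxObj t f x) Set.univ

/-- `p` is a nearest point to `x` in `C`. -/
def IsNearest (C : Set E) (x p : E) : Prop :=
  p ∈ C ∧ dist x p = Metric.infDist x C

/-- The Euclidean projection `P_C(x)`; see `proj_spec` and `proj_unique`. -/
def proj (C : Set E) (x : E) : E := Classical.epsilon (IsNearest C x)

theorem proj_spec [FiniteDimensional ℝ E] {C : Set E} (hC : IsClosed C) (hne : C.Nonempty)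
    (x : E) : IsNearest C x (proj C x) := by
  have : ProperSpace E := FiniteDimensional.proper_rclike ℝ E
  obtain ⟨p, hp, h⟩ := hC.exists_infDist_eq_dist hne x
  exact Classical.epsilon_spec (p := IsNearest C x) ⟨p, hp, h.symm⟩

theorem proj_unique {C : Set E} (hC : Convex ℝ C) {x p : E} (hp : IsNearest C x p) :
    p = proj C x := by
  have hq : IsNearest C x (proj C x) := Classical.epsilon_spec (p := IsNearest C x) ⟨p, hp⟩
  set q := proj C x
  by_contra hne
  have hm : (1 / 2 : ℝ) • p + (1 / 2 : ℝ) • q ∈ C :=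
    hC hp.1 hq.1 (by norm_num) (by norm_num) (by norm_num)
  have h1 := Metric.infDist_le_dist_of_mem (x := x) hm
  have h2 : x - ((1 / 2 : ℝ) • p + (1 / 2 : ℝ) • q)
      = (1 / 2 : ℝ) • ((x - p) + (x - q)) := by module
  have h3 := parallelogram_law_with_norm ℝ (x - p) (x - q)
  have h4 : (x - p) - (x - q) = q - p := by abel
  have h5 : 0 < ‖q - p‖ := norm_pos_iff.2 (sub_ne_zero.2 (Ne.symm hne))
  have hp' := hp.2
  have hq' := hq.2
  rw [dist_eq_norm] at hp' hq' h1
  rw [h2, norm_smul, Real.norm_of_nonneg (by norm_num)] at h1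
  rw [h4, hp', hq'] at h3
  have h6 : 0 ≤ Metric.infDist x C := Metric.infDist_nonneg
  nlinarith [norm_nonneg (x - p + (x - q))]

/-- The function `φ̄` attached to `f` and `x`. -/
def phiBar (f : E → EReal) (x : E) (t : ℝ) : EReal :=
  if 0 < t then -((t : EReal) * moreauEnv t f x)
  else if t = 0 then ((-(1 / 2 * Metric.infDist x (closure (effDom f)) ^ 2) : ℝ) : EReal)
  else -((t : EReal) * f (proj (closure (effDom f)) x))
    - ((1 / 2 * Metric.infDist x (closure (effDom f)) ^ 2 : ℝ) : EReal)

open Classical in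
/-- The post-composition `g ∘ ψ`, equal to `+∞` outside the domain of `ψ`. -/
def postComp (g : ℝ → EReal) (ψ : E → EReal) (x : E) : EReal :=
  if x ∈ effDom ψ then g (ψ x).toReal else ⊤

open Classical in
/-- The multiple `t · ψ`, equal to `+∞` outside the domain of `ψ`; in particular `0 · ψ` is the
indicator function of the domain of `ψ`. -/
def scale (t : ℝ) (ψ : E → EReal) (x : E) : EReal :=
  if x ∈ effDom ψ then (t : EReal) * ψ x else ⊤

/-- The scalar dual objective `t ↦ g*(t) + φ̄(t)`. -/
def dualObj (g : ℝ → EReal) (ψ : E → EReal) (x : E) (t : ℝ) : EReal :=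
  conj g t + phiBar ψ x t

end PostComposition

end

open PostComposition

/-!
Put `F u = ½‖x - u‖²`. Since `g` is nondecreasing, minimizing `g (ψ u) + F u` is the same as
minimizing `g s + F u` subject to the single scalar constraint `ψ u ≤ s`, and the dual problem
of the theorem is the Lagrangian dual: for a multiplier `t ≥ 0` the infimum over `s` of
`g s - t s` is `-g*(t)`, and the infimum over `u` of `t ψ u + F u` is `-φ̄(t)`
(`exists_phiBar_eq`).

* Weak duality is the Fenchel–Young inequality (`neg_le_dualObj`). For strong duality, the
  constraint is perturbed to `ψ u ≤ p + s`. The value is then a convex function of one real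
  variable `p`, and a multiplier is minus the slope of a supporting line at `p = 0`, which is
  obtained by comparing difference quotients (`exists_multiplier`). This needs Slater's condition,
  and the constraint qualification gives it because the domain of a nondecreasing function is
  unbounded below, so that its relative interior is its interior (`exists_gt_mem_effDom`).

* The primal value is finite since a function in `Γ₀` decreases at most linearly
  (`IsGamma0.hasLinearMinorant`) and a nondecreasing function with this property preserves it under
  composition. If `g` is not constant it tends to `+∞`, so the sublevel sets of `g ∘ ψ` are
  sublevel sets of `ψ`; hence `g ∘ ψ` is lower semicontinuous and has exactly one proximal point
  (`exists_proxSet_postComp_eq_singleton`). By complementary slackness this point minimizes the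
  Lagrangian of every optimal multiplier `t` (`proxSet_postComp_subset`), and the minimizer of the
  latter is unique by strict convexity. If `g` is constant, the only multiplier is `0` and
  `g ∘ ψ` is the indicator function of `dom ψ` plus a constant (`proxSet_postComp_eq_of_const`).

* If `0` is an optimal multiplier, equality in weak duality forces the proximal point to be the
  projection of `x` and the value of `ψ` there to minimize `g`, that is, to be a subgradient of
  `g*` at `0` (`mem_subdiff_conj_zero`).
-/

set_option linter.unusedSectionVars false

namespace PostComposition

variable {E : Type*} [NormedAddCommGroup E] [InnerProductSpace ℝ E]

/-! ### Extended-real values and convexity -/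

theorem coe_toReal_of_mem_effDom {f : E → EReal} (hf : ∀ u, f u ≠ ⊥) {u : E}
    (hu : u ∈ effDom f) : ((f u).toReal : EReal) = f u :=
  EReal.coe_toReal (ne_of_lt hu) (hf u)

theorem eq_top_of_notMem_effDom {f : E → EReal} {u : E} (hu : u ∉ effDom f) : f u = ⊤ :=
  not_lt_top_iff.1 hu

theorem le_of_convex_epi {f : E → EReal} (hf : Convex ℝ (epi f)) {u w : E} {r s a b : ℝ}
    (hu : f u ≤ r) (hw : f w ≤ s) (ha : 0 ≤ a) (hb : 0 ≤ b) (hab : a + b = 1) :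
    f (a • u + b • w) ≤ ((a * r + b * s : ℝ) : EReal) :=
  hf (show (u, r) ∈ epi f from hu) (show (w, s) ∈ epi f from hw) ha hb hab

theorem norm_sub_combo_sq_le (x u w : E) {a b : ℝ} (ha : 0 ≤ a) (hb : 0 ≤ b) (hab : a + b = 1) :
    ‖x - (a • u + b • w)‖ ^ 2 ≤ a * ‖x - u‖ ^ 2 + b * ‖x - w‖ ^ 2 := by
  have h1 : x - (a • u + b • w) = a • (x - u) + b • (x - w) := by
    obtain rfl : b = 1 - a := by linarith
    module
  have h2 : ‖x - (a • u + b • w)‖ ≤ a * ‖x - u‖ + b * ‖x - w‖ := by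
    rw [h1]
    refine (norm_add_le _ _).trans_eq ?_
    rw [norm_smul, norm_smul, Real.norm_of_nonneg ha, Real.norm_of_nonneg hb]
  refine (pow_le_pow_left₀ (norm_nonneg _) h2 2).trans ?_
  obtain rfl : b = 1 - a := by linarith
  nlinarith [mul_nonneg (mul_nonneg ha hb) (sq_nonneg (‖x - u‖ - ‖x - w‖))]

/-! ### Lower semicontinuity and linear minorants -/

theorem lowerSemicontinuous_of_isClosed_sublevel {f : E → EReal} (hf : ∀ u, f u ≠ ⊥)
    (h : ∀ r : ℝ, IsClosed {u | f u ≤ r}) : LowerSemicontinuous f := by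
  rw [lowerSemicontinuous_iff_isClosed_preimage]
  intro y
  induction y using EReal.rec with
  | bot =>
    convert! isClosed_empty
    ext u
    simp [hf u]
  | coe r => exact h r
  | top => simp

theorem IsGamma0.isClosed_sublevel {f : E → EReal} (hf : IsGamma0 f) (r : ℝ) :
    IsClosed {u | f u ≤ r} :=
  hf.closed_epi.preimage (f := fun u : E => (u, r)) (by fun_prop)

theorem IsGamma0.lowerSemicontinuous {f : E → EReal} (hf : IsGamma0 f) :
    LowerSemicontinuous f :=
  lowerSemicontinuous_of_isClosed_sublevel hf.ne_bot hf.isClosed_sublevel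

/-- The function `f` decreases at most linearly in the norm. This is all that is needed of an
affine minorant for the quadratic term in the proximal objective to dominate. -/
def HasLinearMinorant (f : E → EReal) : Prop :=
  ∃ a b : ℝ, 0 ≤ b ∧ ∀ u, ((a - b * ‖u‖ : ℝ) : EReal) ≤ f u

/-- On the unit ball about a point of the domain, `f` is bounded below by compactness; along rays
from that point, convexity propagates the bound linearly. -/
theorem IsGamma0.hasLinearMinorant [FiniteDimensional ℝ E] {f : E → EReal} (hf : IsGamma0 f) :
    HasLinearMinorant f := by
  have : ProperSpace E := FiniteDimensional.proper_rclike ℝ E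
  obtain ⟨z, hz⟩ := hf.dom_nonempty
  set r := (f z).toReal with hr
  have hzr : f z = r := (coe_toReal_of_mem_effDom hf.ne_bot hz).symm
  obtain ⟨m, hmr, hm⟩ : ∃ m : ℝ, m ≤ r ∧ ∀ u ∈ Metric.closedBall z 1, (m : EReal) ≤ f u := by
    obtain ⟨p, hp, hmin⟩ := (hf.lowerSemicontinuous.lowerSemicontinuousOn _).exists_isMinOn
      ⟨z, Metric.mem_closedBall_self zero_le_one⟩ (isCompact_closedBall z 1)
    have hpz : f p ≤ f z := hmin (Metric.mem_closedBall_self zero_le_one)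
    have hpd : ((f p).toReal : EReal) = f p :=
      coe_toReal_of_mem_effDom hf.ne_bot (lt_of_le_of_lt hpz hz)
    refine ⟨(f p).toReal, ?_, fun u hu => ?_⟩
    · rw [hzr, ← hpd] at hpz
      exact_mod_cast hpz
    · rw [hpd]
      exact hmin hu
  refine ⟨m - (r - m) * ‖z‖, r - m, by linarith, fun u => ?_⟩
  refine EReal.le_of_forall_lt_iff_le.1 fun y hy => ?_
  have hu : f u ≤ y := hy.le
  have htri : ‖u - z‖ ≤ ‖u‖ + ‖z‖ := norm_sub_le u z
  suffices h : m - (r - m) * ‖u - z‖ ≤ y by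
    have : m - (r - m) * ‖z‖ - (r - m) * ‖u‖ ≤ y := by nlinarith
    exact_mod_cast this
  rcases le_or_gt ‖u - z‖ 1 with hd | hd
  · have h1 : (m : EReal) ≤ y := (hm u (by rwa [mem_closedBall_iff_norm])).trans hu
    have h2 : m ≤ y := by exact_mod_cast h1
    nlinarith [norm_nonneg (u - z)]
  · set d := ‖u - z‖
    have hd0 : 0 < d := by linarith
    have hdi : d⁻¹ ≤ 1 := inv_le_one_of_one_le₀ hd.le
    have h1 := le_of_convex_epi hf.convex_epi hzr.le hu (a := 1 - d⁻¹) (b := d⁻¹)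
      (by linarith) (by positivity) (by ring)
    have h2 : (1 - d⁻¹) • z + d⁻¹ • u ∈ Metric.closedBall z 1 := by
      have : (1 - d⁻¹) • z + d⁻¹ • u - z = d⁻¹ • (u - z) := by module
      rw [mem_closedBall_iff_norm, this, norm_smul, Real.norm_of_nonneg (by positivity)]
      exact (inv_mul_cancel₀ hd0.ne').le
    have h3 : m ≤ (1 - d⁻¹) * r + d⁻¹ * y := by exact_mod_cast (hm _ h2).trans h1
    have h4 : d * m ≤ (d - 1) * r + y := by
      have := mul_le_mul_of_nonneg_left h3 hd0.le
      have e : d * ((1 - d⁻¹) * r + d⁻¹ * y) = (d - 1) * r + y := by field_simp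
      linarith
    nlinarith

/-! ### Moreau envelopes and proximal points -/

theorem HasLinearMinorant.exists_moreauEnv_eq {f : E → EReal} (hf : HasLinearMinorant f)
    (hdom : (effDom f).Nonempty) {t : ℝ} (ht : 0 < t) (x : E) :
    ∃ v : ℝ, moreauEnv t f x = v := by
  obtain ⟨a, b, hb, hab⟩ := hf
  obtain ⟨z, hz⟩ := hdom
  have hlow : ((a - b * ‖x‖ - t * b ^ 2 / 2 : ℝ) : EReal) ≤ moreauEnv t f x := by
    refine le_iInf fun u => ?_
    refine le_trans ?_ (add_le_add_left (hab u) _)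
    have htri : ‖u‖ ≤ ‖x‖ + ‖x - u‖ := by
      have := norm_sub_le x (x - u)
      rwa [sub_sub_cancel] at this
    have key : 1 / (2 * t) * ‖x - u‖ ^ 2 - b * ‖x - u‖ + t * b ^ 2 / 2
        = 1 / (2 * t) * (‖x - u‖ - t * b) ^ 2 := by field_simp; ring
    have : 0 ≤ 1 / (2 * t) * (‖x - u‖ - t * b) ^ 2 := by positivity
    have : a - b * ‖x‖ - t * b ^ 2 / 2 ≤ a - b * ‖u‖ + 1 / (2 * t) * ‖x - u‖ ^ 2 := by nlinarith
    exact_mod_cast this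
  refine ⟨(moreauEnv t f x).toReal, (EReal.coe_toReal ?_ ?_).symm⟩
  · exact ne_of_lt (lt_of_le_of_lt (iInf_le _ z) (EReal.add_lt_top (ne_of_lt hz) (EReal.coe_ne_top _)))
  · exact ne_of_gt (lt_of_lt_of_le (EReal.bot_lt_coe _) hlow)

theorem mem_effDom_of_mem_proxSet {f : E → EReal} (hdom : (effDom f).Nonempty) {t : ℝ} {x u : E}
    (hu : u ∈ proxSet t f x) : u ∈ effDom f := by
  obtain ⟨z, hz⟩ := hdom
  by_contra h
  have hut := eq_top_of_notMem_effDom h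
  have h1 : proxObj t f x u ≤ proxObj t f x z := hu.2 (Set.mem_univ z)
  have h2 : proxObj t f x z < ⊤ := EReal.add_lt_top (ne_of_lt hz) (EReal.coe_ne_top _)
  rw [proxObj, hut, EReal.top_add_coe] at h1
  exact absurd h2 (not_lt.2 h1)

theorem proxSet_one_nonempty [FiniteDimensional ℝ E] {f : E → EReal} (hf : HasLinearMinorant f)
    (hlsc : LowerSemicontinuous f) (hdom : (effDom f).Nonempty) (x : E) :
    (proxSet 1 f x).Nonempty := by
  have : ProperSpace E := FiniteDimensional.proper_rclike ℝ E
  obtain ⟨a, b, hb, hab⟩ := hf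
  obtain ⟨z, hz⟩ := hdom
  have hbot : ∀ u, f u ≠ ⊥ := fun u => ne_of_gt (lt_of_lt_of_le (EReal.bot_lt_coe _) (hab u))
  set M := (f z).toReal + 1 / (2 * 1) * ‖x - z‖ ^ 2 with hM
  have hMz : proxObj 1 f x z = M := by
    rw [proxObj, ← coe_toReal_of_mem_effDom hbot hz, ← EReal.coe_add]
  have hlscF : LowerSemicontinuous (proxObj 1 f x) := by
    refine hlsc.add' ?_ fun u => EReal.continuousAt_add (.inr (EReal.coe_ne_bot _))
      (.inl (hbot u))
    exact (continuous_coe_real_ereal.comp (by fun_prop)).lowerSemicontinuous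
  -- Outside the ball of radius `R` the quadratic term beats the linear minorant.
  set K := |M - a + b * ‖x‖|
  set R := 2 * b + 2 + 2 * K + ‖x - z‖ with hR
  have hK : 0 ≤ K := abs_nonneg _
  have hzR : z ∈ Metric.closedBall x R := by
    rw [mem_closedBall_iff_norm']
    linarith
  obtain ⟨p, hp, hmin⟩ := (hlscF.lowerSemicontinuousOn _).exists_isMinOn
    ⟨z, hzR⟩ (isCompact_closedBall x R)
  refine ⟨p, Set.mem_univ _, fun u _ => ?_⟩
  show proxObj 1 f x p ≤ proxObj 1 f x u
  by_cases hu : u ∈ Metric.closedBall x R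
  · exact hmin hu
  refine le_trans (hmin hzR) ?_
  refine le_trans ?_ (add_le_add_left (hab u) _)
  rw [hMz, ← EReal.coe_add, EReal.coe_le_coe_iff]
  rw [mem_closedBall_iff_norm', not_le] at hu
  have htri : ‖u‖ ≤ ‖x‖ + ‖x - u‖ := by
    have := norm_sub_le x (x - u)
    rwa [sub_sub_cancel] at this
  have h1 : M - a + b * ‖x‖ ≤ K := le_abs_self _
  have h2 : 2 * b + 2 + 2 * K < ‖x - u‖ := by linarith [norm_nonneg (x - z)]
  have h3 : b * ‖u‖ ≤ b * (‖x‖ + ‖x - u‖) := mul_le_mul_of_nonneg_left htri hb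
  nlinarith

theorem proxSet_one_subsingleton {f : E → EReal} (hf : Convex ℝ (epi f)) (hbot : ∀ u, f u ≠ ⊥)
    (hdom : (effDom f).Nonempty) (x : E) : (proxSet 1 f x).Subsingleton := by
  intro u hu w hw
  have hud := (coe_toReal_of_mem_effDom hbot (mem_effDom_of_mem_proxSet hdom hu))
  have hwd := (coe_toReal_of_mem_effDom hbot (mem_effDom_of_mem_proxSet hdom hw))
  set r := (f u).toReal
  set s := (f w).toReal
  have hmid := le_of_convex_epi hf hud.ge hwd.ge (a := 1 / 2) (b := 1 / 2)
    (by norm_num) (by norm_num) (by norm_num)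
  set p := (1 / 2 : ℝ) • u + (1 / 2 : ℝ) • w with hp
  have hup : proxObj 1 f x u ≤ proxObj 1 f x p := hu.2 (Set.mem_univ p)
  have hwp : proxObj 1 f x w ≤ proxObj 1 f x p := hw.2 (Set.mem_univ p)
  have hpp : proxObj 1 f x p ≤
      ((1 / 2 * r + 1 / 2 * s + 1 / (2 * 1) * ‖x - p‖ ^ 2 : ℝ) : EReal) := by
    rw [EReal.coe_add]
    exact add_le_add_left hmid _
  have h1 := hup.trans hpp
  have h2 := hwp.trans hpp
  rw [proxObj, ← hud, ← EReal.coe_add, EReal.coe_le_coe_iff] at h1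
  rw [proxObj, ← hwd, ← EReal.coe_add, EReal.coe_le_coe_iff] at h2
  have h3 := parallelogram_law_with_norm ℝ (x - u) (x - w)
  have h4 : x - u + (x - w) = (2 : ℝ) • (x - p) := by
    rw [hp]
    module
  have h5 : x - u - (x - w) = w - u := by abel
  rw [h4, h5, norm_smul, Real.norm_of_nonneg zero_le_two] at h3
  have h6 : ‖w - u‖ = 0 := by
    nlinarith [norm_nonneg (w - u)]
  exact (sub_eq_zero.1 (norm_eq_zero.1 h6)).symm

/-! ### Values of the dual objective -/

/-- For `t ≥ 0`, `-φ̄(t)` is the infimum of `t ψ + ½‖x - ·‖²` over the domain of `ψ`. -/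
theorem exists_phiBar_eq [FiniteDimensional ℝ E] {ψ : E → EReal} (hψ : IsGamma0 ψ) (x : E)
    {t : ℝ} (ht : 0 ≤ t) :
    ∃ q : ℝ, phiBar ψ x t = ((-q : ℝ) : EReal) ∧
      IsGLB ((fun u => t * (ψ u).toReal + 1 / 2 * ‖x - u‖ ^ 2) '' effDom ψ) q := by
  rcases ht.eq_or_lt with rfl | ht
  · refine ⟨1 / 2 * Metric.infDist x (closure (effDom ψ)) ^ 2, by simp [phiBar], ?_, ?_⟩
    · rintro _ ⟨u, hu, rfl⟩
      have h1 := Metric.infDist_le_dist_of_mem (x := x) (subset_closure hu)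
      rw [dist_eq_norm] at h1
      have := pow_le_pow_left₀ Metric.infDist_nonneg h1 2
      dsimp only
      linarith
    · intro r hr
      rcases le_or_gt r 0 with h0 | h0
      · exact h0.trans (by positivity)
      have h1 : √(2 * r) ≤ Metric.infDist x (closure (effDom ψ)) := by
        rw [Metric.infDist_closure, Metric.le_infDist hψ.dom_nonempty]
        intro u hu
        rw [dist_eq_norm]
        refine Real.sqrt_le_iff.2 ⟨norm_nonneg _, ?_⟩
        have : r ≤ 0 * (ψ u).toReal + 1 / 2 * ‖x - u‖ ^ 2 := hr ⟨u, hu, rfl⟩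
        linarith
      have h2 := pow_le_pow_left₀ (Real.sqrt_nonneg _) h1 2
      rw [Real.sq_sqrt (by positivity)] at h2
      linarith
  · obtain ⟨v, hv⟩ := hψ.hasLinearMinorant.exists_moreauEnv_eq hψ.dom_nonempty ht x
    have hscale : ∀ u, t * ((ψ u).toReal + 1 / (2 * t) * ‖x - u‖ ^ 2)
        = t * (ψ u).toReal + 1 / 2 * ‖x - u‖ ^ 2 := fun u => by field_simp
    have hobj : ∀ u ∈ effDom ψ, proxObj t ψ x u
        = (((ψ u).toReal + 1 / (2 * t) * ‖x - u‖ ^ 2 : ℝ) : EReal) := fun u hu => by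
      rw [EReal.coe_add, coe_toReal_of_mem_effDom hψ.ne_bot hu, proxObj]
    refine ⟨t * v, ?_, ?_, ?_⟩
    · rw [phiBar, if_pos ht, hv, ← EReal.coe_mul, ← EReal.coe_neg]
    · rintro _ ⟨u, hu, rfl⟩
      have h1 : (v : EReal) ≤ proxObj t ψ x u := hv ▸ iInf_le _ u
      rw [hobj u hu, EReal.coe_le_coe_iff] at h1
      have := mul_le_mul_of_nonneg_left h1 ht.le
      rwa [hscale] at this
    · intro r hr
      have h1 : ((r / t : ℝ) : EReal) ≤ moreauEnv t ψ x := by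
        refine le_iInf fun u => ?_
        by_cases hu : u ∈ effDom ψ
        · rw [hobj u hu, EReal.coe_le_coe_iff, div_le_iff₀' ht, hscale]
          exact hr ⟨u, hu, rfl⟩
        · rw [proxObj, eq_top_of_notMem_effDom hu, EReal.top_add_coe]
          exact le_top
      rw [hv, EReal.coe_le_coe_iff, div_le_iff₀' ht] at h1
      exact h1

theorem conj_le_coe_iff {g : ℝ → EReal} (hg : ∀ s, g s ≠ ⊥) {t c : ℝ} :
    conj g t ≤ c ↔ ∀ s ∈ effDom g, t * s - (g s).toReal ≤ c := by
  refine iSup_le_iff.trans (forall_congr' fun s => ?_)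
  have hin : inner ℝ t s = t * s := by simp [mul_comm]
  rw [hin]
  by_cases hs : s ∈ effDom g
  · rw [← coe_toReal_of_mem_effDom hg hs, ← EReal.coe_sub, EReal.coe_le_coe_iff]
    simp [hs]
  · simp [hs, eq_top_of_notMem_effDom hs]

/-! ### The post-composition -/

variable {g : ℝ → EReal} {ψ : E → EReal}

theorem postComp_of_mem {u : E} (hu : u ∈ effDom ψ) : postComp g ψ u = g (ψ u).toReal := if_pos hu

theorem postComp_of_notMem {u : E} (hu : u ∉ effDom ψ) : postComp g ψ u = ⊤ := if_neg hu

theorem mem_effDom_postComp {u : E} :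
    u ∈ effDom (postComp g ψ) ↔ u ∈ effDom ψ ∧ (ψ u).toReal ∈ effDom g := by
  by_cases hu : u ∈ effDom ψ
  · simp [effDom, postComp_of_mem hu, hu.out]
  · have : ¬ ψ u < ⊤ := hu
    simp [effDom, postComp_of_notMem hu, this]

theorem postComp_ne_bot (hg : ∀ s, g s ≠ ⊥) (u : E) : postComp g ψ u ≠ ⊥ := by
  by_cases hu : u ∈ effDom ψ
  · rw [postComp_of_mem hu]
    exact hg _
  · simp [postComp_of_notMem hu]

/-- Membership in a sublevel set of `g ∘ ψ` is witnessed by an upper bound of `ψ u` at which `g`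
is small; this uses that `g` is nondecreasing. -/
theorem postComp_le_iff (hmono : Monotone g) (hψ : ∀ u, ψ u ≠ ⊥) {u : E} {r : ℝ} :
    postComp g ψ u ≤ r ↔ ∃ s : ℝ, ψ u ≤ s ∧ g s ≤ r := by
  constructor
  · intro h
    by_cases hu : u ∈ effDom ψ
    · exact ⟨(ψ u).toReal, (coe_toReal_of_mem_effDom hψ hu).ge, postComp_of_mem (g := g) hu ▸ h⟩
    · rw [postComp_of_notMem hu] at h
      exact absurd (top_le_iff.1 h) (EReal.coe_ne_top r)
  · rintro ⟨s, hs, hr⟩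
    have hu : u ∈ effDom ψ := lt_of_le_of_lt hs (EReal.coe_lt_top s)
    rw [postComp_of_mem hu]
    refine (hmono ?_).trans hr
    rwa [← coe_toReal_of_mem_effDom hψ hu, EReal.coe_le_coe_iff] at hs

theorem convex_epi_postComp (hg : Convex ℝ (epi g)) (hmono : Monotone g)
    (hψ : Convex ℝ (epi ψ)) (hbot : ∀ u, ψ u ≠ ⊥) : Convex ℝ (epi (postComp g ψ)) := by
  rintro ⟨u, r⟩ hu ⟨w, r'⟩ hw a b ha hb hab
  obtain ⟨s, hs, hr⟩ := (postComp_le_iff hmono hbot).1 (show postComp g ψ u ≤ r from hu)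
  obtain ⟨s', hs', hr'⟩ := (postComp_le_iff hmono hbot).1 (show postComp g ψ w ≤ r' from hw)
  exact (postComp_le_iff hmono hbot).2
    ⟨_, le_of_convex_epi hψ hs hs' ha hb hab, le_of_convex_epi hg hr hr' ha hb hab⟩

theorem HasLinearMinorant.postComp (hg : HasLinearMinorant g) (hmono : Monotone g)
    (hψ : HasLinearMinorant ψ) : HasLinearMinorant (postComp g ψ) := by
  obtain ⟨a, b, hb, hab⟩ := hg
  obtain ⟨c, d, hd, hcd⟩ := hψ
  refine ⟨a - b * |c|, b * d, mul_nonneg hb hd, fun u => ?_⟩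
  by_cases hu : u ∈ effDom ψ
  · have hbot : ψ u ≠ ⊥ := ne_of_gt (lt_of_lt_of_le (EReal.bot_lt_coe _) (hcd u))
    have h1 : c - d * ‖u‖ ≤ (ψ u).toReal := by
      rw [← EReal.coe_le_coe_iff, EReal.coe_toReal (ne_of_lt hu) hbot]
      exact hcd u
    rw [postComp_of_mem hu]
    refine le_trans ?_ ((hab _).trans (hmono h1))
    rw [EReal.coe_le_coe_iff, Real.norm_eq_abs]
    have h2 : |c - d * ‖u‖| ≤ |c| + d * ‖u‖ := by
      refine (abs_sub _ _).trans_eq ?_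
      rw [abs_of_nonneg (mul_nonneg hd (norm_nonneg u))]
    nlinarith [mul_le_mul_of_nonneg_left h2 hb]
  · rw [postComp_of_notMem hu]
    exact le_top

/-- A nonconstant nondecreasing convex function on the line tends to `+∞`, so that its sublevel
sets are bounded above. -/
theorem bddAbove_sublevel (hg : IsGamma0 g) (hmono : Monotone g) (hne : ∃ r s, g r ≠ g s)
    (r : ℝ) : BddAbove {s | g s ≤ r} := by
  obtain ⟨s₁, s₂, hs, hlt⟩ : ∃ s₁ s₂ : ℝ, s₁ < s₂ ∧ g s₁ < g s₂ := by
    obtain ⟨p, q, hpq⟩ := hne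
    rcases lt_trichotomy p q with h | rfl | h
    · exact ⟨p, q, h, (hmono h.le).lt_of_ne hpq⟩
    · exact absurd rfl hpq
    · exact ⟨q, p, h, (hmono h.le).lt_of_ne hpq.symm⟩
  obtain ⟨b, hb1, hb2⟩ := EReal.lt_iff_exists_real_btwn.1 hlt
  have hc1 : g s₁ = (g s₁).toReal :=
    (coe_toReal_of_mem_effDom hg.ne_bot (hlt.trans_le le_top)).symm
  set c := (g s₁).toReal
  have hcb : c < b := by
    rw [hc1] at hb1
    exact_mod_cast hb1
  -- The chord from `(s₁, c)` with slope `(b - c) / (s₂ - s₁)` reaches the height `r` here.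
  refine ⟨max s₂ (s₁ + (s₂ - s₁) * (r - c) / (b - c)), fun s hsr => ?_⟩
  by_contra! hcon
  obtain ⟨h1, h2⟩ := max_lt_iff.1 hcon
  have hd : 0 < s - s₁ := by linarith
  have h3 := le_of_convex_epi hg.convex_epi hc1.le (show g s ≤ r from hsr)
    (a := (s - s₂) / (s - s₁)) (b := (s₂ - s₁) / (s - s₁))
    (div_nonneg (by linarith) hd.le) (div_nonneg (by linarith) hd.le) (by field_simp; ring)
  have h4 : ((s - s₂) / (s - s₁)) • s₁ + ((s₂ - s₁) / (s - s₁)) • s = s₂ := by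
    simp only [smul_eq_mul]
    field_simp
    ring
  rw [h4] at h3
  have h5 : b < (s - s₂) / (s - s₁) * c + (s₂ - s₁) / (s - s₁) * r := by
    exact_mod_cast hb2.trans_le h3
  have h6 : (s - s₂) / (s - s₁) * c + (s₂ - s₁) / (s - s₁) * r
      = ((s - s₂) * c + (s₂ - s₁) * r) / (s - s₁) := by ring
  rw [h6, lt_div_iff₀ hd] at h5
  rw [← lt_sub_iff_add_lt', div_lt_iff₀ (by linarith)] at h2
  nlinarith

/-- The sublevel sets of `g` are closed half-lines `(-∞, β]`, so those of `g ∘ ψ` are sublevel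
sets of `ψ`. -/
theorem lowerSemicontinuous_postComp (hg : IsGamma0 g) (hmono : Monotone g) (hψ : IsGamma0 ψ)
    (hne : ∃ r s, g r ≠ g s) : LowerSemicontinuous (postComp g ψ) := by
  refine lowerSemicontinuous_of_isClosed_sublevel (postComp_ne_bot hg.ne_bot) fun r => ?_
  rcases Set.eq_empty_or_nonempty {s | g s ≤ r} with h | h
  · convert! isClosed_empty
    ext u
    simp only [Set.mem_ofPred_eq, postComp_le_iff hmono hψ.ne_bot, Set.mem_empty_iff_false, iff_false]
    rintro ⟨s, -, hs⟩
    exact Set.eq_empty_iff_forall_notMem.1 h s hs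
  · have hbdd := bddAbove_sublevel hg hmono hne r
    convert! hψ.isClosed_sublevel (sSup {s | g s ≤ r}) using 1
    ext u
    simp only [Set.mem_ofPred_eq, postComp_le_iff hmono hψ.ne_bot]
    exact ⟨fun ⟨s, hs, hr⟩ => hs.trans (EReal.coe_le_coe_iff.2 (le_csSup hbdd hr)),
      fun hu => ⟨_, hu, (hg.isClosed_sublevel r).csSup_mem h hbdd⟩⟩

theorem exists_proxSet_postComp_eq_singleton [FiniteDimensional ℝ E] (hg : IsGamma0 g)
    (hmono : Monotone g) (hψ : IsGamma0 ψ) (hdom : (effDom (postComp g ψ)).Nonempty)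
    (hne : ∃ r s, g r ≠ g s) (x : E) : ∃ u, proxSet 1 (postComp g ψ) x = {u} :=
  Set.exists_eq_singleton_iff_nonempty_subsingleton.2
    ⟨proxSet_one_nonempty (hg.hasLinearMinorant.postComp hmono hψ.hasLinearMinorant)
      (lowerSemicontinuous_postComp hg hmono hψ hne) hdom x,
    proxSet_one_subsingleton (convex_epi_postComp hg.convex_epi hmono hψ.convex_epi hψ.ne_bot)
      (postComp_ne_bot hg.ne_bot) hdom x⟩

/-! ### Multiples of a function -/

theorem scale_of_mem {t : ℝ} {u : E} (hψ : ∀ u, ψ u ≠ ⊥) (hu : u ∈ effDom ψ) :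
    scale t ψ u = ((t * (ψ u).toReal : ℝ) : EReal) := by
  rw [EReal.coe_mul, coe_toReal_of_mem_effDom hψ hu]
  exact if_pos hu

theorem scale_of_notMem {t : ℝ} {u : E} (hu : u ∉ effDom ψ) : scale t ψ u = ⊤ := if_neg hu

theorem scale_ne_bot (hψ : ∀ u, ψ u ≠ ⊥) (t : ℝ) (u : E) : scale t ψ u ≠ ⊥ := by
  by_cases hu : u ∈ effDom ψ
  · rw [scale_of_mem hψ hu]
    exact EReal.coe_ne_bot _
  · simp [scale_of_notMem hu]

theorem effDom_scale (hψ : ∀ u, ψ u ≠ ⊥) (t : ℝ) : effDom (scale t ψ) = effDom ψ := by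
  ext u
  by_cases hu : u ∈ effDom ψ
  · exact iff_of_true ((scale_of_mem hψ hu).trans_lt (EReal.coe_lt_top _)) hu
  · exact iff_of_false (by simp [effDom, scale_of_notMem hu]) hu

theorem convex_epi_scale (hψ : Convex ℝ (epi ψ)) (hbot : ∀ u, ψ u ≠ ⊥) {t : ℝ} (ht : 0 ≤ t) :
    Convex ℝ (epi (scale t ψ)) := by
  have aux : ∀ u (r : ℝ), scale t ψ u ≤ r ↔ ∃ s : ℝ, ψ u ≤ s ∧ t * s ≤ r := by
    intro u r
    by_cases hu : u ∈ effDom ψ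
    · rw [scale_of_mem hbot hu, EReal.coe_le_coe_iff]
      refine ⟨fun h => ⟨_, (coe_toReal_of_mem_effDom hbot hu).ge, h⟩, fun ⟨s, hs, hr⟩ => ?_⟩
      rw [← coe_toReal_of_mem_effDom hbot hu, EReal.coe_le_coe_iff] at hs
      exact (mul_le_mul_of_nonneg_left hs ht).trans hr
    · rw [scale_of_notMem hu]
      refine iff_of_false (by simp) ?_
      rintro ⟨s, hs, -⟩
      exact hu (lt_of_le_of_lt hs (EReal.coe_lt_top s))
  rintro ⟨u, r⟩ hu ⟨w, r'⟩ hw a b ha hb hab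
  obtain ⟨s, hs, hr⟩ := (aux _ _).1 hu
  obtain ⟨s', hs', hr'⟩ := (aux _ _).1 hw
  refine (aux _ _).2 ⟨_, le_of_convex_epi hψ hs hs' ha hb hab, ?_⟩
  show t * (a * s + b * s') ≤ a * r + b * r'
  nlinarith [mul_le_mul_of_nonneg_left hr ha, mul_le_mul_of_nonneg_left hr' hb]

/-! ### Lagrange multipliers -/

/-- The one-dimensional supporting-line argument behind strong duality. Think of `S` as the
epigraph of a convex value function that is at least `v` at perturbations `p ≤ 0`; a point with
`p < 0` is Slater's condition. -/
theorem exists_multiplier {S : Set (ℝ × ℝ)} (hS : Convex ℝ S) {v : ℝ}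
    (hv : ∀ z ∈ S, z.1 ≤ 0 → v ≤ z.2) (hslater : ∃ z ∈ S, z.1 < 0) :
    ∃ t : ℝ, 0 ≤ t ∧ ∀ z ∈ S, v ≤ z.2 + t * z.1 := by
  set T : Set ℝ := (fun z : ℝ × ℝ => (z.2 - v) / (-z.1)) '' {z ∈ S | z.1 < 0}
  have hT0 : ∀ y ∈ T, 0 ≤ y := by
    rintro _ ⟨z, ⟨hz, hneg⟩, rfl⟩
    exact div_nonneg (by linarith [hv z hz hneg.le]) (by linarith)
  have hTne : T.Nonempty := by
    obtain ⟨z, hz, hneg⟩ := hslater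
    exact ⟨_, z, ⟨hz, hneg⟩, rfl⟩
  refine ⟨sInf T, Real.sInf_nonneg hT0, fun z hz => ?_⟩
  rcases lt_trichotomy z.1 0 with hneg | h0 | hpos
  · have h1 : sInf T ≤ (z.2 - v) / (-z.1) := csInf_le ⟨0, hT0⟩ ⟨z, ⟨hz, hneg⟩, rfl⟩
    rw [le_div_iff₀ (by linarith)] at h1
    linarith
  · rw [h0, mul_zero, add_zero]
    exact hv z hz h0.le
  · have h1 : (v - z.2) / z.1 ≤ sInf T := by
      refine le_csInf hTne ?_
      rintro _ ⟨w, ⟨hw, hneg⟩, rfl⟩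
      have hd : 0 < z.1 - w.1 := by linarith
      -- The segment from `w` to `z` crosses the axis `p = 0` at height at least `v`.
      have h2 := hv _ (hS hw hz (a := z.1 / (z.1 - w.1)) (b := -w.1 / (z.1 - w.1))
        (div_nonneg hpos.le hd.le) (div_nonneg (by linarith) hd.le) (by field_simp; ring))
        (by simp only [Prod.fst_add, Prod.smul_fst, smul_eq_mul]; apply le_of_eq; ring)
      have h3 : v ≤ (z.1 * w.2 - w.1 * z.2) / (z.1 - w.1) := by
        refine h2.trans_eq ?_
        simp only [Prod.snd_add, Prod.smul_snd, smul_eq_mul]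
        ring
      rw [le_div_iff₀ hd] at h3
      dsimp only
      rw [div_le_div_iff₀ hpos (by linarith)]
      nlinarith
    rw [div_le_iff₀ hpos] at h1
    linarith

/-- The domain of a proper nondecreasing function on the line is unbounded below, so its relative
interior is its interior. -/
theorem exists_gt_mem_effDom (hmono : Monotone g) {s : ℝ}
    (hs : s ∈ intrinsicInterior ℝ (effDom g)) : ∃ s' > s, s' ∈ effDom g := by
  have hsg : s ∈ effDom g := intrinsicInterior_subset hs
  have hsub : Set.Iic s ⊆ effDom g := fun y hy => lt_of_le_of_lt (hmono hy) hsg.out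
  have hspan : affineSpan ℝ (effDom g) = ⊤ := affineSpan_eq_top_of_nonempty_interior <| by
    refine ⟨s - 1, interior_mono (hsub.trans (subset_convexHull ℝ _)) ?_⟩
    rw [interior_Iic]
    simp
  obtain ⟨y, hy, rfl⟩ := mem_intrinsicInterior.1 hs
  rw [mem_interior_iff_mem_nhds, nhds_subtype_eq_comap] at hy
  obtain ⟨U, hU, hUsub⟩ := hy
  obtain ⟨s', hs', hgt⟩ :=
    ((Filter.nonempty_of_mem (Filter.inter_mem (mem_nhdsWithin_of_mem_nhds hU)
      (self_mem_nhdsWithin (a := (y : ℝ)) (s := Set.Ioi (y : ℝ))))))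
  have hmem : s' ∈ affineSpan ℝ (effDom g) := hspan ▸ AffineSubspace.mem_top ℝ ℝ s'
  exact ⟨s', hgt, hUsub (show (⟨s', hmem⟩ : affineSpan ℝ (effDom g)) ∈ _ from hs')⟩

/-! ### Duality -/

theorem dualObj_le_coe_iff {x : E} {t q c : ℝ} (hq : phiBar ψ x t = ((-q : ℝ) : EReal)) :
    dualObj g ψ x t ≤ c ↔ conj g t ≤ ((c + q : ℝ) : EReal) := by
  rw [dualObj, hq]
  generalize conj g t = y
  induction y using EReal.rec with
  | bot => simp
  | coe r =>
    rw [← EReal.coe_add, EReal.coe_le_coe_iff, EReal.coe_le_coe_iff]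
    constructor <;> intro h <;> linarith
  | top =>
    rw [EReal.top_add_coe]
    simp only [top_le_iff, EReal.coe_ne_top]

theorem proxObj_postComp_of_mem {x u : E} (hg : ∀ s, g s ≠ ⊥)
    (hu : u ∈ effDom (postComp g ψ)) :
    proxObj 1 (postComp g ψ) x u
      = (((g (ψ u).toReal).toReal + 1 / 2 * ‖x - u‖ ^ 2 : ℝ) : EReal) := by
  rw [proxObj, mul_one, postComp_of_mem (mem_effDom_postComp.1 hu).1, EReal.coe_add,
    coe_toReal_of_mem_effDom hg (mem_effDom_postComp.1 hu).2]

theorem proxObj_scale_of_mem {x u : E} (hψ : ∀ u, ψ u ≠ ⊥) (t : ℝ) (hu : u ∈ effDom ψ) :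
    proxObj 1 (scale t ψ) x u
      = ((t * (ψ u).toReal + 1 / 2 * ‖x - u‖ ^ 2 : ℝ) : EReal) := by
  rw [proxObj, mul_one, scale_of_mem hψ hu, EReal.coe_add]

/-- Weak duality: by the Fenchel–Young inequality for `g`, every multiplier gives a lower bound of
the primal objective. -/
theorem neg_le_dualObj [FiniteDimensional ℝ E] (hg : IsGamma0 g) (hψ : IsGamma0 ψ) {x : E} {v : ℝ}
    (hv : moreauEnv 1 (postComp g ψ) x = v) {t : ℝ} (ht : 0 ≤ t) :
    ((-v : ℝ) : EReal) ≤ dualObj g ψ x t := by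
  obtain ⟨q, hq, hglb⟩ := exists_phiBar_eq hψ x ht
  refine EReal.le_of_forall_lt_iff_le.1 fun c hc => ?_
  have hconj := (conj_le_coe_iff hg.ne_bot).1 ((dualObj_le_coe_iff hq).1 hc.le)
  have h1 : ((-c : ℝ) : EReal) ≤ moreauEnv 1 (postComp g ψ) x := by
    refine le_iInf fun u => ?_
    by_cases hu : u ∈ effDom (postComp g ψ)
    · obtain ⟨hu1, hu2⟩ := mem_effDom_postComp.1 hu
      rw [proxObj_postComp_of_mem hg.ne_bot hu, EReal.coe_le_coe_iff]
      have h2 := hconj _ hu2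
      have h3 : q ≤ t * (ψ u).toReal + 1 / 2 * ‖x - u‖ ^ 2 := hglb.1 ⟨u, hu1, rfl⟩
      linarith
    · rw [proxObj, eq_top_of_notMem_effDom hu, EReal.top_add_coe]
      exact le_top
  rw [hv, EReal.coe_le_coe_iff] at h1
  rw [EReal.coe_le_coe_iff]
  linarith

/-- Strong duality, with an optimal multiplier, under Slater's condition `ψ u < s ∈ dom g`. -/
theorem exists_dualObj_le [FiniteDimensional ℝ E] (hg : IsGamma0 g) (hmono : Monotone g)
    (hψ : IsGamma0 ψ) {x : E} {v : ℝ} (hv : moreauEnv 1 (postComp g ψ) x = v)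
    (hslater : ∃ u, ∃ s ∈ effDom g, ψ u < (s : EReal)) :
    ∃ t : ℝ, 0 ≤ t ∧ dualObj g ψ x t ≤ ((-v : ℝ) : EReal) := by
  -- The epigraph of the value function that relaxes `ψ u ≤ s` to `ψ u ≤ p + s`.
  let S : Set (ℝ × ℝ) := {z | ∃ u, ∃ s : ℝ,
    ψ u ≤ ((z.1 + s : ℝ) : EReal) ∧ g s ≤ ((z.2 - 1 / 2 * ‖x - u‖ ^ 2 : ℝ) : EReal)}
  have hS : Convex ℝ S := by
    rintro ⟨p, r⟩ ⟨u, s, hu, hs⟩ ⟨p', r'⟩ ⟨u', s', hu', hs'⟩ a b ha hb hab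
    refine ⟨a • u + b • u', a • s + b • s',
      (le_of_convex_epi hψ.convex_epi hu hu' ha hb hab).trans ?_,
      (le_of_convex_epi hg.convex_epi hs hs' ha hb hab).trans ?_⟩
    · rw [EReal.coe_le_coe_iff]
      refine le_of_eq ?_
      simp only [Prod.fst_add, Prod.smul_fst, smul_eq_mul]
      ring
    · rw [EReal.coe_le_coe_iff]
      simp only [Prod.snd_add, Prod.smul_snd, smul_eq_mul]
      linarith [norm_sub_combo_sq_le x u u' ha hb hab]
  have hSv : ∀ z ∈ S, z.1 ≤ 0 → v ≤ z.2 := by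
    rintro ⟨p, r⟩ ⟨u, s, hu, hs⟩ hp
    dsimp only at hu hs hp
    have h1 : postComp g ψ u ≤ ((r - 1 / 2 * ‖x - u‖ ^ 2 : ℝ) : EReal) :=
      (postComp_le_iff hmono hψ.ne_bot).2
        ⟨s, hu.trans (EReal.coe_le_coe_iff.2 (by linarith)), hs⟩
    have h2 : moreauEnv 1 (postComp g ψ) x ≤
        ((r - 1 / 2 * ‖x - u‖ ^ 2 : ℝ) : EReal) + ((1 / (2 * 1) * ‖x - u‖ ^ 2 : ℝ) : EReal) :=
      (iInf_le _ u).trans (add_le_add_left h1 _)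
    rw [hv, ← EReal.coe_add, EReal.coe_le_coe_iff] at h2
    dsimp only
    linarith
  have hSneg : ∃ z ∈ S, z.1 < 0 := by
    obtain ⟨u, s, hs, hus⟩ := hslater
    obtain ⟨c, hc1, hc2⟩ := EReal.lt_iff_exists_real_btwn.1 hus
    refine ⟨(c - s, (g s).toReal + 1 / 2 * ‖x - u‖ ^ 2), ⟨u, s, ?_, ?_⟩, ?_⟩
    · simpa using hc1.le
    · simpa using (coe_toReal_of_mem_effDom hg.ne_bot hs).ge
    · exact sub_neg.2 (EReal.coe_lt_coe_iff.1 hc2)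
  obtain ⟨t, ht, hmul⟩ := exists_multiplier hS hSv hSneg
  obtain ⟨q, hq, hglb⟩ := exists_phiBar_eq hψ x ht
  refine ⟨t, ht, (dualObj_le_coe_iff hq).2 ((conj_le_coe_iff hg.ne_bot).2 fun s hs => ?_)⟩
  have h1 : v + t * s - (g s).toReal ≤ q := by
    refine hglb.2 ?_
    rintro _ ⟨u, hu, rfl⟩
    have h2 := hmul ((ψ u).toReal - s, (g s).toReal + 1 / 2 * ‖x - u‖ ^ 2) ⟨u, s, by
        simpa using (coe_toReal_of_mem_effDom hψ.ne_bot hu).ge,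
      by simpa using (coe_toReal_of_mem_effDom hg.ne_bot hs).ge⟩
    dsimp only at h2 ⊢
    linarith
  linarith

/-! ### Recovering the proximal point from a multiplier -/

/-- The primal value is attained at a proximal point. -/
theorem toReal_add_eq_of_mem_proxSet (hg : ∀ s, g s ≠ ⊥)
    (hdom : (effDom (postComp g ψ)).Nonempty) {x u : E} {v : ℝ}
    (hv : moreauEnv 1 (postComp g ψ) x = v) (hu : u ∈ proxSet 1 (postComp g ψ) x) :
    (g (ψ u).toReal).toReal + 1 / 2 * ‖x - u‖ ^ 2 = v := by
  have h1 : proxObj 1 (postComp g ψ) x u = moreauEnv 1 (postComp g ψ) x :=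
    le_antisymm (le_iInf fun w => hu.2 (Set.mem_univ w)) (iInf_le _ u)
  rw [hv, proxObj_postComp_of_mem hg (mem_effDom_of_mem_proxSet hdom hu)] at h1
  exact_mod_cast h1

/-- At a primal and a dual solution both inequalities of weak duality are equalities; the one that
bounds `-φ̄(t)` says that the primal solution minimizes the Lagrangian. -/
theorem proxSet_postComp_subset [FiniteDimensional ℝ E] (hg : IsGamma0 g) (hψ : IsGamma0 ψ)
    (hdom : (effDom (postComp g ψ)).Nonempty) {x : E} {v : ℝ}
    (hv : moreauEnv 1 (postComp g ψ) x = v) {t : ℝ} (ht : 0 ≤ t)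
    (hdual : dualObj g ψ x t ≤ ((-v : ℝ) : EReal)) :
    proxSet 1 (postComp g ψ) x ⊆ proxSet 1 (scale t ψ) x := by
  intro u hu
  obtain ⟨q, hq, hglb⟩ := exists_phiBar_eq hψ x ht
  obtain ⟨hu1, hu2⟩ := mem_effDom_postComp.1 (mem_effDom_of_mem_proxSet hdom hu)
  have h1 := (conj_le_coe_iff hg.ne_bot).1 ((dualObj_le_coe_iff hq).1 hdual) _ hu2
  have h2 := toReal_add_eq_of_mem_proxSet hg.ne_bot hdom hv hu
  refine ⟨Set.mem_univ u, fun w _ => ?_⟩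
  show proxObj 1 (scale t ψ) x u ≤ proxObj 1 (scale t ψ) x w
  by_cases hw : w ∈ effDom ψ
  · rw [proxObj_scale_of_mem hψ.ne_bot t hu1, proxObj_scale_of_mem hψ.ne_bot t hw,
      EReal.coe_le_coe_iff]
    have h3 : q ≤ t * (ψ w).toReal + 1 / 2 * ‖x - w‖ ^ 2 := hglb.1 ⟨w, hw, rfl⟩
    linarith
  · rw [proxObj.eq_def _ _ _ w, scale_of_notMem hw, EReal.top_add_coe]
    exact le_top

/-- If `g` is constant then its conjugate is finite at `0` only, and `g ∘ ψ` differs from the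
indicator function of the domain of `ψ` by a constant. -/
theorem proxSet_postComp_eq_of_const (hg : IsGamma0 g) (hψ : ∀ u, ψ u ≠ ⊥)
    (hconst : ∀ r s, g r = g s) {t c : ℝ} (hconj : conj g t ≤ c) (ht : 0 ≤ t) (x : E) :
    proxSet 1 (postComp g ψ) x = proxSet 1 (scale t ψ) x := by
  have hdom : ∀ s, s ∈ effDom g := fun s => by
    obtain ⟨r, hr⟩ := hg.dom_nonempty
    exact (hconst s r).trans_lt hr
  obtain rfl : t = 0 := by
    refine ht.eq_of_not_lt' fun ht0 => ?_
    have h1 := (conj_le_coe_iff hg.ne_bot).1 hconj ((c + (g 0).toReal + 1) / t) (hdom _)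
    rw [hconst ((c + (g 0).toReal + 1) / t) 0, mul_div_cancel₀ _ ht0.ne'] at h1
    linarith
  have hobj : ∀ u, proxObj 1 (postComp g ψ) x u
      = proxObj 1 (scale 0 ψ) x u + ((g 0).toReal : EReal) := by
    intro u
    by_cases hu : u ∈ effDom ψ
    · rw [proxObj_postComp_of_mem hg.ne_bot (mem_effDom_postComp.2 ⟨hu, hdom _⟩),
        proxObj_scale_of_mem hψ 0 hu, ← EReal.coe_add, hconst _ 0, EReal.coe_eq_coe_iff]
      ring
    · rw [proxObj, proxObj, postComp_of_notMem hu, scale_of_notMem hu, EReal.top_add_coe,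
        EReal.top_add_coe]
  ext u
  simp only [proxSet, argminOn, isMinOn_iff, hobj]
  have hcancel : ∀ y z : EReal, y + ((g 0).toReal : EReal) ≤ z + ((g 0).toReal : EReal) ↔ y ≤ z :=
    fun y z => (EReal.addLECancellable_coe _).add_le_add_iff_right
  simp only [hcancel]

theorem convex_effDom {f : E → EReal} (hf : Convex ℝ (epi f)) (hbot : ∀ u, f u ≠ ⊥) :
    Convex ℝ (effDom f) := fun _ hu _ hw _ _ ha hb hab =>
  lt_of_le_of_lt (le_of_convex_epi hf (coe_toReal_of_mem_effDom hbot hu).ge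
    (coe_toReal_of_mem_effDom hbot hw).ge ha hb hab) (EReal.coe_lt_top _)

/-- If `0` is a multiplier then the primal solution `u` satisfies
`g (ψ u) + ½‖x - u‖² = inf g + ½ d(x)²`, so it is the projection of `x` onto the closed domain of
`ψ`, and `ψ u` minimizes `g`. -/
theorem mem_subdiff_conj_zero [FiniteDimensional ℝ E] (hg : IsGamma0 g) (hψ : IsGamma0 ψ)
    (hdom : (effDom (postComp g ψ)).Nonempty) {x u : E} {v : ℝ}
    (hv : moreauEnv 1 (postComp g ψ) x = v) (hu : u ∈ proxSet 1 (postComp g ψ) x)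
    (hdual : dualObj g ψ x 0 ≤ ((-v : ℝ) : EReal)) :
    ψ (proj (closure (effDom ψ)) x) ∈ (fun s : ℝ => (s : EReal)) '' subdiff (conj g) 0 := by
  have hphi : phiBar ψ x 0
      = ((-(1 / 2 * Metric.infDist x (closure (effDom ψ)) ^ 2) : ℝ) : EReal) := by simp [phiBar]
  have hconj := (dualObj_le_coe_iff hphi).1 hdual
  obtain ⟨hu1, hu2⟩ := mem_effDom_postComp.1 (mem_effDom_of_mem_proxSet hdom hu)
  have h1 := (conj_le_coe_iff hg.ne_bot).1 hconj _ hu2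
  have h2 := toReal_add_eq_of_mem_proxSet hg.ne_bot hdom hv hu
  have h3 : Metric.infDist x (closure (effDom ψ)) ≤ ‖x - u‖ := by
    rw [← dist_eq_norm]
    exact Metric.infDist_le_dist_of_mem (subset_closure hu1)
  have h4 : ‖x - u‖ ≤ Metric.infDist x (closure (effDom ψ)) :=
    le_of_sq_le_sq (by linarith) Metric.infDist_nonneg
  have hproj : u = proj (closure (effDom ψ)) x :=
    proj_unique (convex_effDom hψ.convex_epi hψ.ne_bot).closure
      ⟨subset_closure hu1, by rw [dist_eq_norm]; exact le_antisymm h4 h3⟩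
  rw [← hproj]
  refine ⟨(ψ u).toReal, fun y => ?_, coe_toReal_of_mem_effDom hψ.ne_bot hu1⟩
  have h5 : conj g 0 ≤ ((-(g (ψ u).toReal).toReal : ℝ) : EReal) := by
    refine hconj.trans (EReal.coe_le_coe_iff.2 ?_)
    have := pow_le_pow_left₀ Metric.infDist_nonneg h3 2
    linarith
  refine (add_le_add_left h5 _).trans ?_
  refine le_trans (le_of_eq ?_)
    (le_iSup (fun s : ℝ => ((inner ℝ y s : ℝ) : EReal) - g s) (ψ u).toReal)
  rw [← coe_toReal_of_mem_effDom hg.ne_bot hu2, ← EReal.coe_add, ← EReal.coe_sub,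
    EReal.coe_eq_coe_iff, EReal.toReal_coe, sub_zero, real_inner_comm]
  ring

end PostComposition

theorem mainTheorem8 {E : Type*} [NormedAddCommGroup E] [InnerProductSpace ℝ E]
    [FiniteDimensional ℝ E] (g : ℝ → EReal) (hg : IsGamma0 g) (hmono : Monotone g)
    (ψ : E → EReal) (hψ : IsGamma0 ψ)
    (hCQ : (((fun s : ℝ => (s : EReal)) '' intrinsicInterior ℝ (effDom g)) ∩
      (ψ '' intrinsicInterior ℝ (effDom ψ))).Nonempty)
    (x : E) :
    (∃ m : ℝ, IsLeast (dualObj g ψ x '' Set.Ici 0) (m : EReal) ∧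
      moreauEnv 1 (postComp g ψ) x = -(m : EReal)) ∧
    ((argminOn (dualObj g ψ x) (Set.Ici 0)).Nonempty ∧
      (∀ t ∈ argminOn (dualObj g ψ x) (Set.Ici 0),
        proxSet 1 (postComp g ψ) x = proxSet 1 (scale t ψ) x) ∧
      ((∃ r s : ℝ, g r ≠ g s) → ∃ u : E, proxSet 1 (postComp g ψ) x = {u})) ∧
    ((∃ r s : ℝ, g r ≠ g s) →
      (ψ (proj (closure (effDom ψ)) x) ∉
          (fun s : ℝ => (s : EReal)) '' subdiff (conj g) 0 →
        argminOn (dualObj g ψ x) (Set.Ici 0) ⊆ Set.Ioi 0) ∧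
      (proj (closure (effDom ψ)) x ∉ effDom ψ →
        ψ (proj (closure (effDom ψ)) x) ∉
            (fun s : ℝ => (s : EReal)) '' subdiff (conj g) 0 ∧
          argminOn (dualObj g ψ x) (Set.Ici 0) ⊆ Set.Ioi 0)) := by
  obtain ⟨_, ⟨s₀, hs₀, rfl⟩, u₀, hu₀, hψu₀⟩ := hCQ
  dsimp only at hψu₀
  have hdom : (effDom (postComp g ψ)).Nonempty :=
    ⟨u₀, mem_effDom_postComp.2 ⟨intrinsicInterior_subset hu₀, by
      rw [hψu₀, EReal.toReal_coe]
      exact intrinsicInterior_subset hs₀⟩⟩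
  obtain ⟨v, hv⟩ := (hg.hasLinearMinorant.postComp hmono hψ.hasLinearMinorant).exists_moreauEnv_eq
    hdom one_pos x
  obtain ⟨s₁, hs₁, hs₁g⟩ := exists_gt_mem_effDom hmono hs₀
  obtain ⟨t₀, ht₀, hdual₀⟩ := exists_dualObj_le hg hmono hψ hv
    ⟨u₀, s₁, hs₁g, hψu₀ ▸ EReal.coe_lt_coe_iff.2 hs₁⟩
  have hweak : ∀ t ∈ Set.Ici (0 : ℝ), ((-v : ℝ) : EReal) ≤ dualObj g ψ x t :=
    fun t ht => neg_le_dualObj hg hψ hv ht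
  have hΛ : ∀ t ∈ argminOn (dualObj g ψ x) (Set.Ici 0),
      0 ≤ t ∧ dualObj g ψ x t ≤ ((-v : ℝ) : EReal) :=
    fun t ht => ⟨ht.1, (show dualObj g ψ x t ≤ dualObj g ψ x t₀ from ht.2 ht₀).trans hdual₀⟩
  have hsingle := exists_proxSet_postComp_eq_singleton hg hmono hψ hdom (x := x)
  have hpos : (∃ r s : ℝ, g r ≠ g s) → ψ (proj (closure (effDom ψ)) x) ∉
      (fun s : ℝ => (s : EReal)) '' subdiff (conj g) 0 →
      argminOn (dualObj g ψ x) (Set.Ici 0) ⊆ Set.Ioi 0 := by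
    intro hne hnot t ht
    obtain ⟨ht0, hdual⟩ := hΛ t ht
    refine lt_of_le_of_ne ht0 ?_
    rintro rfl
    obtain ⟨u, hu⟩ := hsingle hne
    exact hnot (mem_subdiff_conj_zero hg hψ hdom hv (hu ▸ Set.mem_singleton u) hdual)
  refine ⟨⟨-v, ⟨⟨t₀, ht₀, le_antisymm hdual₀ (hweak t₀ ht₀)⟩, ?_⟩, ?_⟩,
    ⟨⟨t₀, ht₀, fun t ht => hdual₀.trans (hweak t ht)⟩, ?_, hsingle⟩,
    fun hne => ⟨hpos hne, fun hnot => ?_⟩⟩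
  · rintro _ ⟨t, ht, rfl⟩
    exact hweak t ht
  · rw [hv, ← EReal.coe_neg, neg_neg]
  · intro t ht
    obtain ⟨ht0, hdual⟩ := hΛ t ht
    by_cases hne : ∃ r s : ℝ, g r ≠ g s
    · -- A singleton contained in a set with at most one element.
      have hsub := proxSet_postComp_subset hg hψ hdom hv ht0 hdual
      obtain ⟨u, hu⟩ := hsingle hne
      rw [hu, Set.singleton_subset_iff] at hsub
      rw [hu]
      refine (Set.Subsingleton.eq_singleton_of_mem ?_ hsub).symm
      exact proxSet_one_subsingleton (convex_epi_scale hψ.convex_epi hψ.ne_bot ht0)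
        (scale_ne_bot hψ.ne_bot t) ((effDom_scale hψ.ne_bot t).symm ▸ hψ.dom_nonempty) x
    · push Not at hne
      obtain ⟨q, hq, -⟩ := exists_phiBar_eq hψ x ht0
      exact proxSet_postComp_eq_of_const hg hψ.ne_bot hne ((dualObj_le_coe_iff hq).1 hdual) ht0 x
  · have htop : ψ (proj (closure (effDom ψ)) x) ∉
        (fun s : ℝ => (s : EReal)) '' subdiff (conj g) 0 := by
      rintro ⟨s, -, hs⟩
      exact hnot (hs ▸ EReal.coe_lt_top s : ψ (proj (closure (effDom ψ)) x) < ⊤)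
    exact ⟨htop, hpos hne htop⟩
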